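/- **Setting.** For an integer $N\ge1$ let $\Lambda_N=\{k\in\mathbb Z^3\setminus\{0\}:|k|_\infty\le N\}$ and $|k|^2=k_1^2+k_2^2+k_3^2$. The octahedral group $O_h$ (the 48 signed permutations of the coordinates) acts on $\Lambda_N$; its orbits are denoted $\Omega_\alpha$. For Fourier data $\hat u=(\hat u_k)_{k\in\Lambda_N}$, $\hat u_k\in\mathbb C^3$, let $P(k)=I-k\otimes k/|k|^2$ and define the orbit transfer matrix and the orbit-level stretching matrix by $$S_{\alpha\beta}=\frac1{|\Omega_\alpha|}\sum_{k\in\Omega_\alpha}\ \sum_{\substack{p\in\Omega_\beta\\ q=k-p\in\Lambda_N}}|k|^2\,\mathrm{Re}\Bigl(\overline{\hat u_k}\cdot(-i)P(k)\bigl[q\,(\hat u_p\cdot\hat u_q)\bigr]\Bigr),\qquad V_{\alpha\beta}=\tfrac12\,(S_{\alpha\beta}+S_{\beta\alpha}),$$ where $a\cdot b=\sum_i a_ib_i$ is bilinear. Let $V_N=(V_{\alpha\beta})$, let $\|V_N\|_\infty$ be its maximal absolute row sum, $\rho(V_N)$ its spectral radius, and $\nu_c^*(N)=\rho(V_N)/N^2$.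 **Ensemble.** Let $\Lambda_N^+$ be the half of $\Lambda_N$ consisting of the $k$ whose first nonzero coordinate is positive. A random isotropic unit-energy ensemble at level $N$ is the law of a random field $\hat u$ obtained as follows: take independent complex random variables $X_{k,j}$ ($k\in\Lambda_N^+$, $j=1,2,3$), put $v_k=P(k)X_k$ and $v_{-k}=\overline{v_k}$ for $k\in\Lambda_N^+$, and normalize $\hat u=v/\sqrt W$ with $W=\frac12\sum_{k\in\Lambda_N}|k|^2|v_k|^2$; it is required that the law of $\hat u$ be $O_h$-invariant (under $(g\hat u)_{gk}=g\,\hat u_k$) and that almost surely $\hat u_{-k}=\overline{\hat u_k}$, $k\cdot\hat u_k=0$ and $\frac12\sum_{k\in\Lambda_N}|k|^2|\hat u_k|^2=1$. (For example, the $X_{k,j}$ may be independent standard complex Gaussians.) **Theorem (second-moment stretching bound).** For every $\varepsilon>0$ there is a constant $C_\varepsilon>0$ such that for every $N\ge1$ and every such ensemble at level $N$, the quantities $\|V_N\|_\infty$, $\rho(V_N)$ and $\nu_c^*(N)$ are integrable and $$\mathbb E\,\|V_N\|_\infty\le C_\varepsilon N^{1/2+\varepsilon},\qquad \mathbb E\,\rho(V_N)\le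 C_\varepsilon N^{1/2+\varepsilon},\qquad \mathbb E\,\nu_c^*(N)\le C_\varepsilon N^{-3/2+\varepsilon}.$$ In particular, for any choice of one such ensemble for each $N\ge 1$, $\mathbb E\,\nu_c^*(N)\to0$ as $N\to\infty$. -/

import Mathlib

open MeasureTheory ProbabilityTheory Filter
open scoped Topology Matrix ComplexConjugate

noncomputable section

namespace OrbitStretching

/-! ### The truncated lattice and the octahedral group -/

/-- The truncated nonzero Fourier lattice: `k ∈ ℤ³ \ {0}` with `|k|_∞ ≤ N`. -/
def lattice (N : ℕ) : Finset (Fin 3 → ℤ) :=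
  (Fintype.piFinset fun _ => Finset.Icc (-(N : ℤ)) N).erase 0

theorem mem_lattice {N : ℕ} {k : Fin 3 → ℤ} :
    k ∈ lattice N ↔ k ≠ 0 ∧ ∀ i, |k i| ≤ (N : ℤ) := by
  simp [lattice, abs_le]

/-- A retained Fourier mode. -/
abbrev Mode (N : ℕ) : Type := ↥(lattice N)

/-- The opposite mode `-k`. -/
def negMode {N : ℕ} (k : Mode N) : Mode N :=
  ⟨-k.1, by
    have h := mem_lattice.1 k.2
    exact mem_lattice.2 ⟨neg_ne_zero.2 h.1, fun i => by simpa using h.2 i⟩⟩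

/-- `|k|² = k₁² + k₂² + k₃²`. -/
def modeSq {N : ℕ} (k : Mode N) : ℝ := ∑ i, ((k.1 i : ℤ) : ℝ) ^ 2

/-- The full octahedral group `O_h`, realised as the 48 signed permutations of three
coordinates: a permutation together with a choice of signs. -/
abbrev Oct : Type := Equiv.Perm (Fin 3) × (Fin 3 → ℤˣ)

/-- The signed permutation `g = (σ, s)` acts on vectors by `(g x)_i = s_i x_{σ(i)}`. -/
def Oct.act {R : Type*} [Ring R] (g : Oct) (x : Fin 3 → R) : Fin 3 → R :=
  fun i => (((g.2 i : ℤˣ) : ℤ) : R) * x (g.1 i)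

/-- The inverse signed permutation. -/
def Oct.inv (g : Oct) : Oct := (g.1⁻¹, fun j => g.2 (g.1⁻¹ j))

theorem Oct.inv_act_act {R : Type*} [Ring R] (g : Oct) (x : Fin 3 → R) :
    g.inv.act (g.act x) = x := by
  funext i
  rcases Int.units_eq_one_or (g.2 (g.1⁻¹ i)) with h | h <;> simp_all [Oct.act, Oct.inv]

theorem Oct.act_inv_act {R : Type*} [Ring R] (g : Oct) (x : Fin 3 → R) :
    g.act (g.inv.act x) = x := by
  funext i
  rcases Int.units_eq_one_or (g.2 i) with h | h <;> simp_all [Oct.act, Oct.inv]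

theorem Oct.act_mem {N : ℕ} (g : Oct) {k : Fin 3 → ℤ} (hk : k ∈ lattice N) :
    g.act k ∈ lattice N := by
  have h := mem_lattice.1 hk
  refine mem_lattice.2 ⟨fun h0 => h.1 ?_, fun i => ?_⟩
  · rw [← g.inv_act_act k, h0]
    funext i
    simp [Oct.act]
  · rcases Int.units_eq_one_or (g.2 i) with hs | hs <;> simpa [Oct.act, hs] using h.2 (g.1 i)

/-- The action of `O_h` on the retained modes. -/
def Oct.actMode {N : ℕ} (g : Oct) (k : Mode N) : Mode N := ⟨g.act k.1, g.act_mem k.2⟩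

/-- Two modes are equivalent when they lie in the same `O_h`-orbit. -/
def orbitSetoid (N : ℕ) : Setoid (Mode N) where
  r k l := ∃ g : Oct, g.actMode k = l
  iseqv :=
    { refl := fun k => ⟨(1, 1), Subtype.ext (by funext i; simp [Oct.actMode, Oct.act])⟩
      symm := by
        rintro k l ⟨g, rfl⟩
        exact ⟨g.inv, Subtype.ext (g.inv_act_act k.1)⟩
      trans := by
        rintro k l m ⟨g, rfl⟩ ⟨h, rfl⟩
        refine ⟨(g.1 * h.1, fun i => h.2 i * g.2 (h.1 i)), Subtype.ext ?_⟩
        funext i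
        simp [Oct.actMode, Oct.act, mul_assoc] }

/-- The orbit set `Λ_N / O_h`. -/
def Orbit (N : ℕ) : Type := Quotient (orbitSetoid N)

instance (N : ℕ) : DecidableEq (Orbit N) := Classical.decEq _

instance (N : ℕ) : Fintype (Orbit N) :=
  @Quotient.fintype _ _ (orbitSetoid N) (Classical.decRel _)

/-- The orbit of a mode. -/
def orbitOf {N : ℕ} (k : Mode N) : Orbit N := Quotient.mk (orbitSetoid N) k

/-- The orbit `Ω_α`, as a set of modes. -/
def Orbit.modes {N : ℕ} (α : Orbit N) : Finset (Mode N) :=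
  Finset.univ.filter fun k => orbitOf k = α

/-! ### Fourier fields and the orbit-level stretching matrix -/

/-- Truncated Fourier data: a coefficient `û_k ∈ ℂ³` for each retained mode `k`. -/
abbrev Field (N : ℕ) : Type := Mode N → Fin 3 → ℂ

/-- A mode as a complex vector. -/
def cvec {N : ℕ} (k : Mode N) : Fin 3 → ℂ := fun i => ((k.1 i : ℤ) : ℂ)

/-- The Leray projector `P(k) = I - k ⊗ k / |k|²`. -/
def leray {N : ℕ} (k : Mode N) (w : Fin 3 → ℂ) : Fin 3 → ℂ :=
  w - ((cvec k ⬝ᵥ w) / (modeSq k : ℂ)) • cvec k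

/-- The total energy functional `½ ∑_k |k|² |û_k|²` whose value is normalized to one. -/
def energy {N : ℕ} (u : Field N) : ℝ :=
  (1 / 2) * ∑ k, modeSq k * ∑ i, ‖u k i‖ ^ 2

/-- The contribution `|k|² Re( conj û_k · N_{k,p} )` of the triad `k = p + q`, where
`N_{k,p} = -i P(k)[q (û_p · û_q)]`; the dot is the bilinear one. -/
def triadTransfer {N : ℕ} (u : Field N) (k p q : Mode N) : ℝ :=
  modeSq k *
    ((fun i => conj (u k i)) ⬝ᵥ
      ((-Complex.I) • leray k ((u p ⬝ᵥ u q) • cvec q))).re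

/-- The raw orbit-pair transfer matrix `S`. -/
def transferMatrix {N : ℕ} (u : Field N) : Matrix (Orbit N) (Orbit N) ℝ :=
  Matrix.of fun α β =>
    (1 / (α.modes.card : ℝ)) *
      ∑ k ∈ α.modes, ∑ p ∈ β.modes,
        ∑ q : Mode N with q.1 = k.1 - p.1, triadTransfer u k p q

/-- The orbit-level stretching matrix `V_N`, the symmetric part of the transfer matrix. -/
def stretchingMatrix {N : ℕ} (u : Field N) : Matrix (Orbit N) (Orbit N) ℝ :=
  Matrix.of fun α β => (transferMatrix u α β + transferMatrix u β α) / 2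

open scoped Matrix.Norms.Operator in
/-- The matrix `ℓ^∞` norm of `V_N` (the operator norm on `ℓ^∞`: the maximal absolute row sum). -/
def stretchingNorm {N : ℕ} (u : Field N) : ℝ := ‖stretchingMatrix u‖

/-- The spectral radius of `V_N`: the largest modulus of a complex eigenvalue. -/
def stretchingRadius {N : ℕ} (u : Field N) : ℝ :=
  (spectralRadius ℂ ((stretchingMatrix u).map (fun x : ℝ => (x : ℂ)))).toReal

/-- The critical-threshold ratio `ν_c^*(N) = ρ(V_N) / N²`. -/
def criticalRatio {N : ℕ} (u : Field N) : ℝ := stretchingRadius u / (N : ℝ) ^ 2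

/-! ### The random isotropic unit-energy ensemble -/

/-- The lexicographic half of the lattice: the first nonzero coordinate is positive. Exactly one
of `k`, `-k` satisfies this. -/
def IsPositive {N : ℕ} (k : Mode N) : Prop :=
  0 < k.1 0 ∨ (k.1 0 = 0 ∧ (0 < k.1 1 ∨ (k.1 1 = 0 ∧ 0 < k.1 2)))

instance {N : ℕ} (k : Mode N) : Decidable (IsPositive k) := by
  unfold IsPositive; infer_instance

theorem isPositive_negMode {N : ℕ} {k : Mode N} : IsPositive (negMode k) ↔ ¬ IsPositive k := by
  have h0 : ¬ (k.1 0 = 0 ∧ k.1 1 = 0 ∧ k.1 2 = 0) := by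
    rintro ⟨h0, h1, h2⟩
    apply (mem_lattice.1 k.2).1
    funext i
    fin_cases i <;> simpa
  simp only [IsPositive, negMode, Pi.neg_apply]
  omega

/-- Index set of the basic coordinates: three complex coordinates per half-lattice mode. -/
abbrev Coord (N : ℕ) : Type := {k : Mode N // IsPositive k} × Fin 3

/-- The unnormalized field built from coordinates `X`: the coordinates of each half-lattice mode
are projected onto `k^⊥`, and the other half is filled in by `v_{-k} = conj v_k`. -/
def rawField {N : ℕ} (X : Coord N → ℂ) : Field N := fun k =>
  if h : IsPositive k then
    leray k fun j => X (⟨k, h⟩, j)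
  else
    fun i => conj (leray (negMode k) (fun j => X (⟨negMode k, isPositive_negMode.2 h⟩, j)) i)

/-- The normalized field `û = v / √W`, where `W` is the energy of `v`. -/
def unitField {N : ℕ} (X : Coord N → ℂ) : Field N := fun k i =>
  rawField X k i / ((√(energy (rawField X)) : ℝ) : ℂ)

/-- The natural action of `O_h` on fields: `(g u)_{g k} = g û_k`. -/
def Oct.actField {N : ℕ} (g : Oct) (u : Field N) : Field N := fun k =>
  g.act (u (g.inv.actMode k))

/-- `μ` is the law of a random isotropic unit-energy field on the truncated phase space. -/
structure IsIsotropicUnitEnergyEnsemble (N : ℕ) (μ : Measure (Field N)) : Prop where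
  /-- The field comes from independent complex half-lattice coordinates (whose joint law is a
  product of probability measures) by projection, reality and normalization. -/
  independent_coordinates : ∃ ν : Coord N → ProbabilityMeasure ℂ,
    μ = (Measure.pi fun m => (ν m : Measure ℂ)).map unitField
  /-- The law is invariant under the octahedral group. -/
  isotropic : ∀ g : Oct, μ.map g.actField = μ
  /-- Almost sure reality. -/
  reality : ∀ᵐ u ∂μ, ∀ k i, u (negMode k) i = conj (u k i)
  /-- Almost sure incompressibility. -/
  incompressible : ∀ᵐ u ∂μ, ∀ k, cvec k ⬝ᵥ u k = 0
  /-- Unit total energy. -/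
  unit_energy : ∀ᵐ u ∂μ, energy u = 1

/-! ### The Gaussian ensemble is an instance -/

/-- The standard complex Gaussian law: independent real and imaginary parts of variance `1/2`. -/
def stdComplexGaussian : Measure ℂ :=
  ((gaussianReal 0 (1 / 2)).prod (gaussianReal 0 (1 / 2))).map Complex.measurableEquivRealProd.symm

instance : IsProbabilityMeasure stdComplexGaussian :=
  Measure.isProbabilityMeasure_map Complex.measurableEquivRealProd.symm.measurable.aemeasurable

instance : NullSingletonClass stdComplexGaussian := by
  have h : NullSingletonClass (gaussianReal 0 (1 / 2)) :=
    nullSingletonClass_gaussianReal (by norm_num)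
  constructor
  intro z
  rw [stdComplexGaussian, MeasurableEquiv.map_apply]
  have h2 : (Complex.measurableEquivRealProd.symm : ℝ × ℝ → ℂ) ⁻¹' {z} = {z.re} ×ˢ {z.im} := by
    ext x
    simp [Complex.ext_iff, Prod.ext_iff]
  rw [h2, Measure.prod_prod, measure_singleton, zero_mul]

theorem map_neg_gauss : (gaussianReal 0 (1/2)).map (fun x => -x) = gaussianReal 0 (1/2) := by
  simpa using gaussianReal_map_neg (μ := 0) (v := 1/2)

theorem mp_neg : MeasurePreserving (fun x : ℝ => -x) (gaussianReal 0 (1/2)) (gaussianReal 0 (1/2)) :=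
  ⟨measurable_neg, map_neg_gauss⟩

theorem mp_conj : MeasurePreserving (fun z : ℂ => conj z) stdComplexGaussian stdComplexGaussian := by
  refine ⟨Complex.continuous_conj.measurable, ?_⟩
  rw [stdComplexGaussian, Measure.map_map Complex.continuous_conj.measurable (MeasurableEquiv.measurable _)]
  have h := ((MeasurePreserving.id (gaussianReal 0 (1/2))).prod mp_neg).map_eq
  conv_rhs => rw [← h, Measure.map_map (MeasurableEquiv.measurable _) (by fun_prop)]
  congr 1

theorem mp_negC : MeasurePreserving (fun z : ℂ => -z) stdComplexGaussian stdComplexGaussian := by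
  refine ⟨measurable_neg, ?_⟩
  rw [stdComplexGaussian, Measure.map_map measurable_neg (MeasurableEquiv.measurable _)]
  have h := (mp_neg.prod mp_neg).map_eq
  conv_rhs => rw [← h, Measure.map_map (MeasurableEquiv.measurable _) (by fun_prop)]
  congr 1

theorem negMode_negMode {N : ℕ} (k : Mode N) : negMode (negMode k) = k :=
  Subtype.ext (neg_neg k.1)

theorem act_negMode {N : ℕ} (g : Oct) (k : Mode N) :
    g.actMode (negMode k) = negMode (g.actMode k) :=
  Subtype.ext (by funext i; simp [Oct.actMode, negMode, Oct.act])

theorem inv_actMode {N : ℕ} (g : Oct) (k : Mode N) : g.inv.actMode (g.actMode k) = k :=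
  Subtype.ext (g.inv_act_act k.1)

theorem actMode_inv {N : ℕ} (g : Oct) (k : Mode N) : g.actMode (g.inv.actMode k) = k :=
  Subtype.ext (g.act_inv_act k.1)

theorem modeSq_pos {N : ℕ} (k : Mode N) : 0 < modeSq k := by
  unfold modeSq
  obtain ⟨i, hi⟩ := Function.ne_iff.1 (mem_lattice.1 k.2).1
  have hi : ((k.1 i : ℤ) : ℝ) ≠ 0 := by exact_mod_cast hi
  exact Finset.sum_pos' (fun j _ => sq_nonneg _) ⟨i, Finset.mem_univ _, by positivity⟩

/-- The coordinates extended to all modes by the reality constraint. -/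
def fullCoord {N : ℕ} (X : Coord N → ℂ) (k : Mode N) : Fin 3 → ℂ :=
  if h : IsPositive k then fun j => X (⟨k, h⟩, j)
  else fun j => conj (X (⟨negMode k, isPositive_negMode.2 h⟩, j))

theorem fullCoord_neg {N : ℕ} (X : Coord N → ℂ) (k : Mode N) (i) :
    fullCoord X (negMode k) i = conj (fullCoord X k i) := by
  by_cases h : IsPositive k
  · have h' : ¬ IsPositive (negMode k) := by rw [isPositive_negMode]; exact not_not.2 h
    simp [fullCoord, h, h', negMode_negMode]
  · have h' : IsPositive (negMode k) := by rw [isPositive_negMode]; exact h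
    simp [fullCoord, h, h']

theorem modeSq_neg {N : ℕ} (k : Mode N) : modeSq (negMode k) = modeSq k := by
  simp [modeSq, negMode]

theorem cvec_neg {N : ℕ} (k : Mode N) : cvec (negMode k) = - cvec k := by
  funext i; simp [cvec, negMode]

theorem leray_neg {N : ℕ} (k : Mode N) (w) : leray (negMode k) w = leray k w := by
  simp [leray, modeSq_neg, cvec_neg, neg_div]

theorem leray_conj {N : ℕ} (k : Mode N) (w : Fin 3 → ℂ) (i) :
    conj (leray k w i) = leray k (fun j => conj (w j)) i := by
  simp [leray, dotProduct, cvec]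

theorem rawField_eq {N : ℕ} (X : Coord N → ℂ) (k : Mode N) :
    rawField X k = leray k (fullCoord X k) := by
  by_cases h : IsPositive k
  · simp [rawField, fullCoord, h]
  · funext i
    simp only [rawField, fullCoord, h, dite_false, leray_neg, leray_conj]

theorem act_sum {R : Type*} [CommRing R] (g : Oct) (x y : Fin 3 → R) :
    g.act x ⬝ᵥ g.act y = x ⬝ᵥ y := by
  simp only [dotProduct, Oct.act]
  rw [← Equiv.sum_comp g.1 (fun i => x i * y i)]
  refine Finset.sum_congr rfl fun i _ => ?_
  rcases Int.units_eq_one_or (g.2 i) with h | h <;> simp [h]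

theorem cvec_act {N : ℕ} (g : Oct) (k : Mode N) : cvec (g.actMode k) = g.act (cvec k) := by
  funext i; simp [cvec, Oct.actMode, Oct.act]

theorem modeSq_eq {N : ℕ} (k : Mode N) : (modeSq k : ℂ) = cvec k ⬝ᵥ cvec k := by
  simp [modeSq, cvec, dotProduct, sq]

theorem leray_act {N : ℕ} (g : Oct) (k : Mode N) (w) :
    leray (g.actMode k) (g.act w) = g.act (leray k w) := by
  simp only [leray, modeSq_eq, cvec_act, act_sum]
  funext i
  simp [Oct.act]; ring

/-- The action of `O_h` on the basic coordinates. -/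
def actCoord {N : ℕ} (g : Oct) (X : Coord N → ℂ) : Coord N → ℂ := fun m =>
  g.act (fullCoord X (g.inv.actMode m.1.1)) m.2

theorem fullCoord_actCoord {N : ℕ} (g : Oct) (X : Coord N → ℂ) (k : Mode N) :
    fullCoord (actCoord g X) k = g.act (fullCoord X (g.inv.actMode k)) := by
  by_cases h : IsPositive k
  · rw [fullCoord, dif_pos h]; rfl
  · rw [fullCoord, dif_neg h]
    funext i
    simp [actCoord, act_negMode, Oct.act, fullCoord_neg]

theorem rawField_actCoord {N : ℕ} (g : Oct) (X : Coord N → ℂ) :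
    rawField (actCoord g X) = g.actField (rawField X) := by
  funext k
  rw [rawField_eq, fullCoord_actCoord, Oct.actField, rawField_eq, ← leray_act, actMode_inv]

theorem modeSq_act {N : ℕ} (g : Oct) (k : Mode N) : modeSq (g.actMode k) = modeSq k := by
  have := modeSq_eq (g.actMode k)
  rw [cvec_act, act_sum, ← modeSq_eq] at this
  exact_mod_cast this

theorem energy_act {N : ℕ} (g : Oct) (u : Field N) : energy (g.actField u) = energy u := by
  unfold energy
  congr 1
  let e : Mode N ≃ Mode N := ⟨g.inv.actMode, g.actMode, actMode_inv g, inv_actMode g⟩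
  rw [← Equiv.sum_comp e (fun k => modeSq k * ∑ i, ‖u k i‖ ^ 2)]
  refine Finset.sum_congr rfl fun k _ => ?_
  have h1 : modeSq (e k) = modeSq k := by
    conv_rhs => rw [← actMode_inv g k, modeSq_act]
    rfl
  rw [h1]
  congr 1
  rw [← Equiv.sum_comp g.1 (fun i => ‖u (e k) i‖ ^ 2)]
  refine Finset.sum_congr rfl fun i _ => ?_
  rcases Int.units_eq_one_or (g.2 i) with h | h <;> simp [Oct.actField, Oct.act, h, e]

theorem unitField_actCoord {N : ℕ} (g : Oct) (X : Coord N → ℂ) :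
    unitField (actCoord g X) = g.actField (unitField X) := by
  funext k i
  simp only [unitField, rawField_actCoord, energy_act]
  simp only [Oct.actField, Oct.act]
  simp [unitField, mul_div_assoc]

/-- The half-lattice representative of `{k, -k}`. -/
def rep {N : ℕ} (k : Mode N) : {k : Mode N // IsPositive k} :=
  if h : IsPositive k then ⟨k, h⟩ else ⟨negMode k, isPositive_negMode.2 h⟩

/-- The permutation of the coordinate indices underlying `actCoord`. -/
def permCoord {N : ℕ} (g : Oct) (m : Coord N) : Coord N := (rep (g.inv.actMode m.1.1), g.1 m.2)

theorem permCoord_inj {N : ℕ} (g : Oct) : Function.Injective (permCoord (N := N) g) := by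
  rintro ⟨⟨k, hk⟩, i⟩ ⟨⟨l, hl⟩, j⟩ h
  simp only [permCoord, Prod.mk.injEq, EmbeddingLike.apply_eq_iff_eq] at h
  obtain ⟨h, rfl⟩ := h
  have h' := congrArg (fun z => g.actMode z.1) h
  have key : ∀ k : Mode N, g.actMode (rep (g.inv.actMode k)).1 = k ∨
      g.actMode (rep (g.inv.actMode k)).1 = negMode k := by
    intro k
    unfold rep
    split_ifs
    · left; exact actMode_inv g k
    · right; simp only [act_negMode, actMode_inv]
  have : k = l := by
    rcases key k with a | a <;> rcases key l with b | b <;> rw [a, b] at h'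
    · exact h'
    · exact absurd hl (isPositive_negMode.1 (h' ▸ hk))
    · exact absurd hk (isPositive_negMode.1 (h' ▸ hl))
    · rw [← negMode_negMode k, h', negMode_negMode]
  subst this; rfl

/-- The concrete ensemble with standard complex Gaussian half-lattice coordinates. -/
def gaussianLaw (N : ℕ) : Measure (Field N) :=
  (Measure.pi fun _ : Coord N => stdComplexGaussian).map unitField

theorem mp_actCoord {N : ℕ} (g : Oct) :
    MeasurePreserving (actCoord (N := N) g) (Measure.pi fun _ : Coord N => stdComplexGaussian)
      (Measure.pi fun _ : Coord N => stdComplexGaussian) := by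
  let e : Coord N ≃ Coord N := Equiv.ofBijective _ (Finite.injective_iff_bijective.1 (permCoord_inj g))
  have : ∀ m : Coord N, ∃ f : ℂ → ℂ, MeasurePreserving f stdComplexGaussian stdComplexGaussian ∧
      ∀ X, actCoord g X m = f (X (e m)) := by
    intro m
    have he : e m = permCoord g m := rfl
    by_cases h : IsPositive (g.inv.actMode m.1.1)
    · rcases Int.units_eq_one_or (g.2 m.2) with hs | hs
      · exact ⟨id, .id _, fun X => by simp [actCoord, Oct.act, hs, fullCoord, h, he, permCoord, rep]⟩
      · exact ⟨_, mp_negC, fun X => by simp [actCoord, Oct.act, hs, fullCoord, h, he, permCoord, rep]⟩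
    · rcases Int.units_eq_one_or (g.2 m.2) with hs | hs
      · exact ⟨_, mp_conj, fun X => by simp [actCoord, Oct.act, hs, fullCoord, h, he, permCoord, rep]⟩
      · exact ⟨_, mp_negC.comp mp_conj, fun X => by simp [actCoord, Oct.act, hs, fullCoord, h, he, permCoord, rep]⟩
  choose f hf hX using this
  have h1 : MeasurePreserving (fun (X : Coord N → ℂ) m => f m (X m))
    (Measure.pi fun _ : Coord N => stdComplexGaussian)
      (Measure.pi fun _ : Coord N => stdComplexGaussian) := measurePreserving_pi _ _ hf
  have h2 := measurePreserving_piCongrLeft (fun _ : Coord N => stdComplexGaussian) e.symm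
  have h3 := h1.comp h2
  convert h3 using 1
  funext X m
  rw [hX]
  simp only [Function.comp]
  congr 1
  have h4 := Equiv.piCongrLeft_apply_apply (fun _ : Coord N => ℂ) e.symm X (e m)
  rw [Equiv.symm_apply_apply] at h4
  exact h4.symm

theorem measurable_rawField {N : ℕ} : Measurable (rawField (N := N)) := by
  have he : ∀ (k : Mode N) i, Measurable fun X : Coord N → ℂ => fullCoord X k i := by
    intro k i
    by_cases h : IsPositive k
    · simp only [fullCoord, h, dite_true]; fun_prop
    · simp only [fullCoord, h, dite_false]
      exact Complex.continuous_conj.measurable.comp (measurable_pi_apply _)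
  refine measurable_pi_lambda _ fun k => measurable_pi_lambda _ fun i => ?_
  simp only [rawField_eq, leray, dotProduct, Pi.sub_apply, Pi.smul_apply, smul_eq_mul]
  fun_prop

theorem measurable_energy {N : ℕ} : Measurable (energy (N := N)) := by
  unfold energy; fun_prop

theorem measurable_unitField {N : ℕ} : Measurable (unitField (N := N)) := by
  have := measurable_rawField (N := N)
  have := measurable_energy (N := N)
  refine measurable_pi_lambda _ fun k => measurable_pi_lambda _ fun i => ?_
  unfold unitField
  fun_prop

theorem measurable_actField {N : ℕ} (g : Oct) : Measurable (g.actField (N := N)) := by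
  refine measurable_pi_lambda _ fun k => measurable_pi_lambda _ fun i => ?_
  unfold Oct.actField Oct.act
  fun_prop

theorem energy_unit {N : ℕ} (X : Coord N → ℂ) (h : energy (rawField X) ≠ 0) :
    energy (unitField X) = 1 := by
  have h0 : 0 ≤ energy (rawField X) := by
    unfold energy
    have := fun k : Mode N => (modeSq_pos k).le
    refine mul_nonneg (by norm_num) (Finset.sum_nonneg fun k _ => mul_nonneg (this k) (by positivity))
  have : energy (unitField X) = energy (rawField X) / energy (rawField X) := by
    conv_lhs => unfold energy
    simp only [unitField, norm_div, div_pow, Complex.norm_real, Real.norm_eq_abs, sq_abs, Real.sq_sqrt h0]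
    simp only [← Finset.sum_div, ← mul_div_assoc]
    rfl
  rw [this, div_self h]

/-- The Gaussian ensemble is an isotropic unit-energy ensemble. -/
theorem gaussian_isEnsemble (N : ℕ) (hN : 1 ≤ N) :
    IsIsotropicUnitEnergyEnsemble N (gaussianLaw N) where
  independent_coordinates := ⟨fun _ => ⟨stdComplexGaussian, inferInstance⟩, rfl⟩
  isotropic g := by
    rw [gaussianLaw, Measure.map_map (measurable_actField g) measurable_unitField]
    conv_rhs => rw [← (mp_actCoord g).map_eq, Measure.map_map measurable_unitField (mp_actCoord g).measurable]
    congr 1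
    funext X
    exact (unitField_actCoord g X).symm
  reality := by
    rw [gaussianLaw, ae_map_iff measurable_unitField.aemeasurable]
    · refine Eventually.of_forall fun X k i => ?_
      simp only [unitField, rawField_eq, map_div₀, Complex.conj_ofReal, leray_conj, leray_neg]
      congr 2
      funext j
      exact fullCoord_neg X k j
    · simp only [Set.ofPred_forall]
      refine MeasurableSet.iInter fun k => MeasurableSet.iInter fun i => measurableSet_eq_fun (by fun_prop) ?_
      exact Complex.continuous_conj.measurable.comp (by fun_prop)
  incompressible := by
    rw [gaussianLaw, ae_map_iff measurable_unitField.aemeasurable]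
    · refine Eventually.of_forall fun X k => ?_
      have : unitField X k = ((√(energy (rawField X)) : ℝ) : ℂ)⁻¹ • leray k (fullCoord X k) := by
        funext i
        simp [unitField, rawField_eq, div_eq_inv_mul]
      have h0 : cvec k ⬝ᵥ cvec k ≠ 0 := by
        rw [← modeSq_eq]; exact_mod_cast (modeSq_pos k).ne'
      rw [this, dotProduct_smul, leray, dotProduct_sub, dotProduct_smul, modeSq_eq, smul_eq_mul,
        smul_eq_mul, div_mul_cancel₀ _ h0, sub_self, mul_zero]
    · simp only [Set.ofPred_forall, dotProduct]
      exact MeasurableSet.iInter fun k => measurableSet_eq_fun (by fun_prop) (by fun_prop)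
  unit_energy := by
    rw [gaussianLaw, ae_map_iff measurable_unitField.aemeasurable
      (measurableSet_eq_fun measurable_energy measurable_const)]
    let k : Mode N := ⟨![1, 0, 0], mem_lattice.2 ⟨fun h => by simpa using congrFun h 0, fun i => by
      fin_cases i <;> simp <;> omega⟩⟩
    have hk : IsPositive k := Or.inl (by simp [k])
    have h0 : ∀ᵐ X ∂(Measure.pi fun _ : Coord N => stdComplexGaussian), X (⟨k, hk⟩, 1) ≠ 0 :=
      Measure.ae_eval_ne (μ := fun _ : Coord N => stdComplexGaussian) (⟨k, hk⟩, 1) 0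
    filter_upwards [h0] with X hX
    refine energy_unit X fun hE => hX ?_
    unfold energy at hE
    have h1 := (mul_eq_zero.1 hE).resolve_left (by norm_num)
    have h2 := (Finset.sum_eq_zero_iff_of_nonneg (fun k _ => mul_nonneg (modeSq_pos k).le
      (by positivity))).1 h1 k (Finset.mem_univ _)
    have h3 := (mul_eq_zero.1 h2).resolve_left (modeSq_pos k).ne'
    have h4 := (Finset.sum_eq_zero_iff_of_nonneg (fun i _ => by positivity)).1 h3 1 (Finset.mem_univ _)
    have h5 : rawField X k 1 = 0 := by simpa using h4
    rw [rawField, dif_pos hk] at h5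
    simpa [leray, cvec, k] using h5

end OrbitStretching

end

namespace OrbitStretching

/-! ### Deterministic bounds on the triad transfer -/

/-! The bound is deterministic: every divergence-free field of unit energy has `‖V_N‖_∞` bounded by
an absolute constant, which is stronger than growth of order `N^(1/2+ε)`. Averaging against a
probability measure then preserves the bound.

Put `a_k = |k| |û_k|`. Unit energy says `∑ a_k² = 2`. Since `û_k ⟂ k` and `k = p + q`, the pairings
of `conj û_k` with `q` and with `p` differ only by a sign, so each is at most `|û_k| min(|p|, |q|)`.
With `|k| ≤ |p| + |q|` this absorbs the weight `|k|²` and gives a triad term of size at most `2 a_k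
a_p a_q` (`abs_triadTransfer_le`).

This bound is symmetric in the three modes. Fixing any one of them leaves an `ℓ² * ℓ² → ℓ^∞`
convolution in the other two (`sum_filter_mul_le`), so the mode-level row and column sums are all at
most 8. Passing to orbits costs nothing for rows, because of the factor `1/|Ω_α|`, and at most the
group order for columns. Rows of `V` average a row and a column of `S`, which bounds the norm; the
norm dominates the spectral radius, and division by `N²` gives the critical ratio. -/

/-- The Hermitian norm on `ℂ³`. -/
noncomputable def euclNorm (w : Fin 3 → ℂ) : ℝ := √(∑ i, ‖w i‖ ^ 2)

theorem euclNorm_nonneg (w : Fin 3 → ℂ) : 0 ≤ euclNorm w := Real.sqrt_nonneg _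

theorem norm_dotProduct_le (x y : Fin 3 → ℂ) : ‖x ⬝ᵥ y‖ ≤ euclNorm x * euclNorm y := by
  refine (norm_sum_le _ _).trans ?_
  simp only [norm_mul]
  exact Real.sum_mul_le_sqrt_mul_sqrt _ _ _

theorem euclNorm_cvec {N : ℕ} (k : Mode N) : euclNorm (cvec k) = √(modeSq k) := by
  simp [euclNorm, cvec, modeSq]

theorem euclNorm_conj (w : Fin 3 → ℂ) : euclNorm (fun i => conj (w i)) = euclNorm w := by
  simp [euclNorm]

theorem euclNorm_add_le (x y : Fin 3 → ℂ) : euclNorm (x + y) ≤ euclNorm x + euclNorm y := by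
  simpa [euclNorm, EuclideanSpace.norm_eq] using norm_add_le (WithLp.toLp 2 x) (WithLp.toLp 2 y)

/-- The enstrophy-weighted amplitude `|k| |û_k|` of a mode. -/
noncomputable def amplitude {N : ℕ} (u : Field N) (k : Mode N) : ℝ :=
  √(modeSq k) * euclNorm (u k)

theorem amplitude_nonneg {N : ℕ} (u : Field N) (k : Mode N) : 0 ≤ amplitude u k :=
  mul_nonneg (Real.sqrt_nonneg _) (euclNorm_nonneg _)

/-- The weight `|k|²` is built into the energy, so the energy normalization is exactly an `ℓ²`
normalization of the amplitudes; the 2 undoes the factor ½. -/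
theorem sum_amplitude_sq {N : ℕ} (u : Field N) : ∑ k, amplitude u k ^ 2 = 2 * energy u := by
  have h : ∀ k, amplitude u k ^ 2 = modeSq k * ∑ i, ‖u k i‖ ^ 2 := fun k => by
    rw [amplitude, mul_pow, Real.sq_sqrt (modeSq_pos k).le, euclNorm,
      Real.sq_sqrt (Finset.sum_nonneg fun i _ => sq_nonneg _)]
  simp only [h, energy]
  ring

theorem conj_dotProduct_cvec {N : ℕ} {u : Field N} {k : Mode N} (h : cvec k ⬝ᵥ u k = 0) :
    (fun i => conj (u k i)) ⬝ᵥ cvec k = 0 := by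
  have := congrArg conj h
  simpa [dotProduct, cvec, mul_comm] using this

/-- `P(k)` only subtracts a multiple of the real vector `k`, to which `conj û_k` is orthogonal, so
the projector disappears from the pairing. -/
theorem conj_dotProduct_leray {N : ℕ} {u : Field N} {k : Mode N} (h : cvec k ⬝ᵥ u k = 0)
    (w : Fin 3 → ℂ) :
    (fun i => conj (u k i)) ⬝ᵥ leray k w = (fun i => conj (u k i)) ⬝ᵥ w := by
  rw [leray, dotProduct_sub, dotProduct_smul, conj_dotProduct_cvec h, smul_zero, sub_zero]

/-- The transverse pairing gains the smaller of the two input wavenumbers. -/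
theorem abs_triadTransfer_le {N : ℕ} {u : Field N} {k p q : Mode N}
    (hu : cvec k ⬝ᵥ u k = 0) (hq : q.1 = k.1 - p.1) :
    |triadTransfer u k p q| ≤ 2 * (amplitude u k * (amplitude u p * amplitude u q)) := by
  have hk : cvec k = cvec p + cvec q := by
    funext i
    simp [cvec, hq]
  set U : Fin 3 → ℂ := fun i => conj (u k i) with hU
  have hT : triadTransfer u k p q =
      modeSq k * ((-Complex.I) * ((u p ⬝ᵥ u q) * (U ⬝ᵥ cvec q))).re := by
    rw [triadTransfer, dotProduct_smul, conj_dotProduct_leray hu, dotProduct_smul]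
    rfl
  -- Orthogonality to `k = p + q` lets `q` be traded for `-p`, so either wavenumber can serve as the
  -- bound.
  have hpq : U ⬝ᵥ cvec q = - (U ⬝ᵥ cvec p) := by
    have := conj_dotProduct_cvec hu
    rw [hk, dotProduct_add] at this
    exact eq_neg_of_add_eq_zero_right this
  have hUn : euclNorm U = euclNorm (u k) := euclNorm_conj _
  have h1 : ‖U ⬝ᵥ cvec q‖ ≤ euclNorm (u k) * √(modeSq q) := by
    rw [← hUn, ← euclNorm_cvec]; exact norm_dotProduct_le _ _
  have h2 : ‖U ⬝ᵥ cvec q‖ ≤ euclNorm (u k) * √(modeSq p) := by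
    rw [hpq, norm_neg, ← hUn, ← euclNorm_cvec]; exact norm_dotProduct_le _ _
  have h3 : √(modeSq k) ≤ √(modeSq p) + √(modeSq q) := by
    rw [← euclNorm_cvec, ← euclNorm_cvec, ← euclNorm_cvec, hk]
    exact euclNorm_add_le _ _
  have hp0 := Real.sqrt_nonneg (modeSq p)
  have hq0 := Real.sqrt_nonneg (modeSq q)
  -- After splitting `|k| ≤ |p| + |q|`, the `|p|` term uses the bound by `|q|` and the `|q|` term
  -- the bound by `|p|`: both become `|û_k| |p| |q|`, hence the 2.
  have h4 : √(modeSq k) * ‖U ⬝ᵥ cvec q‖ ≤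
      2 * (euclNorm (u k) * (√(modeSq p) * √(modeSq q))) := by
    calc √(modeSq k) * ‖U ⬝ᵥ cvec q‖ ≤ (√(modeSq p) + √(modeSq q)) * ‖U ⬝ᵥ cvec q‖ := by gcongr
      _ = √(modeSq p) * ‖U ⬝ᵥ cvec q‖ + √(modeSq q) * ‖U ⬝ᵥ cvec q‖ := add_mul _ _ _
      _ ≤ √(modeSq p) * (euclNorm (u k) * √(modeSq q)) +
          √(modeSq q) * (euclNorm (u k) * √(modeSq p)) := by gcongr
      _ = _ := by ring
  have h5 : |((-Complex.I) * ((u p ⬝ᵥ u q) * (U ⬝ᵥ cvec q))).re| ≤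
      euclNorm (u p) * euclNorm (u q) * ‖U ⬝ᵥ cvec q‖ := by
    refine (Complex.abs_re_le_norm _).trans ?_
    rw [norm_mul, norm_mul, norm_neg, Complex.norm_I, one_mul]
    gcongr
    exact norm_dotProduct_le _ _
  have hp1 := euclNorm_nonneg (u p)
  have hq1 := euclNorm_nonneg (u q)
  have hk0 := Real.sqrt_nonneg (modeSq k)
  rw [hT, abs_mul, abs_of_pos (modeSq_pos k)]
  calc modeSq k * |((-Complex.I) * ((u p ⬝ᵥ u q) * (U ⬝ᵥ cvec q))).re|
      ≤ modeSq k * (euclNorm (u p) * euclNorm (u q) * ‖U ⬝ᵥ cvec q‖) :=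
        mul_le_mul_of_nonneg_left h5 (modeSq_pos k).le
    -- One factor `|k|` is kept for the amplitude of `k`; the other is spent in `h4`.
    _ = √(modeSq k) * euclNorm (u p) * euclNorm (u q) * (√(modeSq k) * ‖U ⬝ᵥ cvec q‖) := by
        nth_rewrite 1 [← Real.mul_self_sqrt (modeSq_pos k).le]
        ring
    _ ≤ √(modeSq k) * euclNorm (u p) * euclNorm (u q) *
          (2 * (euclNorm (u k) * (√(modeSq p) * √(modeSq q)))) := by gcongr
    _ = _ := by simp only [amplitude]; ring

/-- A Young inequality for sums over the graph of a partial injection. -/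
theorem sum_filter_mul_le {ι : Type*} [Fintype ι] (R : ι → ι → Prop) [∀ p, DecidablePred (R p)]
    (hl : ∀ p q q', R p q → R p q' → q = q') (hr : ∀ p p' q, R p q → R p' q → p = p')
    (a : ι → ℝ) :
    ∑ p, ∑ q with R p q, a p * a q ≤ ∑ p, a p ^ 2 := by
  have h1 : ∀ p, ∑ q with R p q, a p ^ 2 ≤ a p ^ 2 := fun p => by
    rw [Finset.sum_const, nsmul_eq_mul]
    refine mul_le_of_le_one_left (sq_nonneg _) ?_
    exact_mod_cast Finset.card_le_one.2 fun q hq q' hq' => by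
      simp only [Finset.mem_filter, Finset.mem_univ, true_and] at hq hq'
      exact hl p q q' hq hq'
  have h2 : ∀ q, ∑ p, (if R p q then a q ^ 2 else 0) ≤ a q ^ 2 := fun q => by
    rw [← Finset.sum_filter, Finset.sum_const, nsmul_eq_mul]
    refine mul_le_of_le_one_left (sq_nonneg _) ?_
    exact_mod_cast Finset.card_le_one.2 fun p hp p' hp' => by
      simp only [Finset.mem_filter, Finset.mem_univ, true_and] at hp hp'
      exact hr p p' q hp hp'
  have h3 : ∑ p, ∑ q with R p q, a q ^ 2 ≤ ∑ p, a p ^ 2 := by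
    simp only [Finset.sum_filter]
    rw [Finset.sum_comm]
    exact Finset.sum_le_sum fun q _ => h2 q
  have h4 : ∑ p, ∑ q with R p q, a p ^ 2 ≤ ∑ p, a p ^ 2 := Finset.sum_le_sum fun p _ => h1 p
  -- AM-GM decouples the product; each half is then summed using that every index has at most one
  -- partner on either side.
  have h5 : ∑ p, ∑ q with R p q, a p * a q ≤
      ∑ p, ∑ q with R p q, (1 / 2 * a p ^ 2 + 1 / 2 * a q ^ 2) :=
    Finset.sum_le_sum fun p _ => Finset.sum_le_sum fun q _ => by
      nlinarith [sq_nonneg (a p - a q)]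
  refine h5.trans ?_
  simp only [Finset.sum_add_distrib]
  simp only [← Finset.mul_sum]
  linarith

/-! ### Row and column sums of the transfer matrix -/

/-- Deterministic constraints satisfied almost surely by a unit-energy ensemble. -/
structure IsUnitField {N : ℕ} (u : Field N) : Prop where
  incompressible : ∀ k, cvec k ⬝ᵥ u k = 0
  unit_energy : energy u = 1

/-- A single square is at most the total 2, so the sharp value would be `√2`; 2 is a rounder
constant. -/
theorem IsUnitField.amplitude_le {N : ℕ} {u : Field N} (hu : IsUnitField u) (k : Mode N) :
    amplitude u k ≤ 2 := by
  have h := sum_amplitude_sq u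
  rw [hu.unit_energy] at h
  have := Finset.single_le_sum (f := fun k => amplitude u k ^ 2) (fun k _ => sq_nonneg _)
    (Finset.mem_univ k)
  nlinarith [amplitude_nonneg u k]

/-- The absolute transfer into `k` through all triads with given first input mode `p`. -/
noncomputable def absTransfer {N : ℕ} (u : Field N) (k p : Mode N) : ℝ :=
  ∑ q : Mode N with q.1 = k.1 - p.1, |triadTransfer u k p q|

theorem absTransfer_nonneg {N : ℕ} (u : Field N) (k p : Mode N) : 0 ≤ absTransfer u k p :=
  Finset.sum_nonneg fun _ _ => abs_nonneg _

/-- For fixed `k`, `p ↦ k - p` is injective. The 8 is the triad constant 2, times `a_k ≤ 2`, times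
`∑ a² = 2`. -/
theorem IsUnitField.sum_absTransfer_right_le {N : ℕ} {u : Field N} (hu : IsUnitField u)
    (k : Mode N) : ∑ p, absTransfer u k p ≤ 8 := by
  have h := sum_filter_mul_le (fun p q : Mode N => q.1 = k.1 - p.1)
    (fun p q q' h h' => Subtype.ext (h.trans h'.symm))
    (fun p p' q h h' => Subtype.ext (sub_right_injective (h.symm.trans h'))) (amplitude u)
  rw [sum_amplitude_sq, hu.unit_energy] at h
  calc ∑ p, absTransfer u k p
      ≤ ∑ p, ∑ q : Mode N with q.1 = k.1 - p.1,
          2 * amplitude u k * (amplitude u p * amplitude u q) := by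
        refine Finset.sum_le_sum fun p _ => Finset.sum_le_sum fun q hq => ?_
        simp only [Finset.mem_filter, Finset.mem_univ, true_and] at hq
        rw [mul_assoc]
        exact abs_triadTransfer_le (hu.incompressible k) hq
    _ = 2 * amplitude u k * ∑ p, ∑ q : Mode N with q.1 = k.1 - p.1,
          amplitude u p * amplitude u q := by simp only [Finset.mul_sum]
    _ ≤ 2 * 2 * (2 * 1) := by
        exact mul_le_mul (mul_le_mul_of_nonneg_left (hu.amplitude_le k) zero_le_two) h
          (Finset.sum_nonneg fun _ _ => Finset.sum_nonneg fun _ _ =>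
            mul_nonneg (amplitude_nonneg u _) (amplitude_nonneg u _)) (by norm_num)
    _ = 8 := by norm_num

/-- The triad bound does not distinguish output from input modes, so `a_p` can be pulled out instead
and the convolution estimate applied along `k ↦ k - p`. -/
theorem IsUnitField.sum_absTransfer_left_le {N : ℕ} {u : Field N} (hu : IsUnitField u)
    (p : Mode N) : ∑ k, absTransfer u k p ≤ 8 := by
  have h := sum_filter_mul_le (fun k q : Mode N => q.1 = k.1 - p.1)
    (fun k q q' h h' => Subtype.ext (h.trans h'.symm))
    (fun k k' q h h' => Subtype.ext (sub_left_injective (h.symm.trans h'))) (amplitude u)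
  rw [sum_amplitude_sq, hu.unit_energy] at h
  calc ∑ k, absTransfer u k p
      ≤ ∑ k, ∑ q : Mode N with q.1 = k.1 - p.1,
          2 * amplitude u p * (amplitude u k * amplitude u q) := by
        refine Finset.sum_le_sum fun k _ => Finset.sum_le_sum fun q hq => ?_
        simp only [Finset.mem_filter, Finset.mem_univ, true_and] at hq
        refine (abs_triadTransfer_le (hu.incompressible k) hq).trans_eq ?_
        ring
    _ = 2 * amplitude u p * ∑ k, ∑ q : Mode N with q.1 = k.1 - p.1,
          amplitude u k * amplitude u q := by simp only [Finset.mul_sum]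
    _ ≤ 2 * 2 * (2 * 1) := by
        exact mul_le_mul (mul_le_mul_of_nonneg_left (hu.amplitude_le p) zero_le_two) h
          (Finset.sum_nonneg fun _ _ => Finset.sum_nonneg fun _ _ =>
            mul_nonneg (amplitude_nonneg u _) (amplitude_nonneg u _)) (by norm_num)
    _ = 8 := by norm_num

/-! ### Passage from modes to orbits -/

theorem sum_orbit_modes {N : ℕ} (f : Mode N → ℝ) :
    ∑ β : Orbit N, ∑ p ∈ β.modes, f p = ∑ p, f p :=
  Finset.sum_fiberwise _ _ _

theorem orbitOf_surjective {N : ℕ} : Function.Surjective (orbitOf (N := N)) :=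
  Quotient.exists_rep

theorem Orbit.modes_nonempty {N : ℕ} (α : Orbit N) : α.modes.Nonempty := by
  obtain ⟨k, rfl⟩ := orbitOf_surjective α
  exact ⟨k, Finset.mem_filter.2 ⟨Finset.mem_univ _, rfl⟩⟩

theorem Orbit.card_modes_pos {N : ℕ} (α : Orbit N) : 0 < (α.modes.card : ℝ) := by
  exact_mod_cast α.modes_nonempty.card_pos

/-- An orbit is an image of the group, so its size is bounded independently of `N`; this keeps the
column sums uniform. -/
theorem Orbit.card_modes_le {N : ℕ} (α : Orbit N) : α.modes.card ≤ Fintype.card Oct := by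
  obtain ⟨k, rfl⟩ := orbitOf_surjective α
  refine (Finset.card_le_card (t := Finset.univ.image fun g : Oct => g.actMode k) ?_).trans
    Finset.card_image_le
  intro l hl
  have h := (Finset.mem_filter.1 hl).2
  obtain ⟨g, hg⟩ := (orbitSetoid N).symm (Quotient.exact (show orbitOf l = orbitOf k from h))
  exact Finset.mem_image.2 ⟨g, Finset.mem_univ _, hg⟩

theorem abs_transferMatrix_le {N : ℕ} (u : Field N) (α β : Orbit N) :
    |transferMatrix u α β| ≤
      (1 / (α.modes.card : ℝ)) * ∑ k ∈ α.modes, ∑ p ∈ β.modes, absTransfer u k p := by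
  rw [transferMatrix, Matrix.of_apply, abs_mul, abs_of_nonneg (by positivity)]
  gcongr
  refine (Finset.abs_sum_le_sum_abs _ _).trans (Finset.sum_le_sum fun k _ => ?_)
  refine (Finset.abs_sum_le_sum_abs _ _).trans (Finset.sum_le_sum fun p _ => ?_)
  exact Finset.abs_sum_le_sum_abs _ _

/-- An orbit row is the average over `k ∈ Ω_α` of mode-level rows, so no constant is lost. -/
theorem IsUnitField.row_sum_le {N : ℕ} {u : Field N} (hu : IsUnitField u) (α : Orbit N) :
    ∑ β, |transferMatrix u α β| ≤ 8 := by
  calc ∑ β, |transferMatrix u α β|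
      ≤ ∑ β : Orbit N,
          (1 / (α.modes.card : ℝ)) * ∑ k ∈ α.modes, ∑ p ∈ β.modes, absTransfer u k p :=
        Finset.sum_le_sum fun β _ => abs_transferMatrix_le u α β
    _ = (1 / (α.modes.card : ℝ)) * ∑ k ∈ α.modes, ∑ p, absTransfer u k p := by
        rw [← Finset.mul_sum, Finset.sum_comm]
        simp only [sum_orbit_modes]
    _ ≤ (1 / (α.modes.card : ℝ)) * ∑ k ∈ α.modes, (8 : ℝ) := by
        gcongr with k
        exact hu.sum_absTransfer_right_le k
    _ = 8 := by
        have := α.card_modes_pos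
        rw [Finset.sum_const, nsmul_eq_mul]
        field_simp

/-- Here the prefactor `1/|Ω_α|` does not average the summed variable `p ∈ Ω_β`. It is discarded as
at most 1, and `|Ω_β|` columns are added. -/
theorem IsUnitField.col_sum_le {N : ℕ} {u : Field N} (hu : IsUnitField u) (β : Orbit N) :
    ∑ α, |transferMatrix u α β| ≤ Fintype.card Oct * 8 := by
  calc ∑ α, |transferMatrix u α β|
      ≤ ∑ α : Orbit N, ∑ k ∈ α.modes, ∑ p ∈ β.modes, absTransfer u k p := by
        refine Finset.sum_le_sum fun α _ => (abs_transferMatrix_le u α β).trans ?_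
        refine mul_le_of_le_one_left (Finset.sum_nonneg fun k _ => Finset.sum_nonneg fun p _ =>
          absTransfer_nonneg u k p) ?_
        rw [div_le_one α.card_modes_pos]
        exact_mod_cast α.modes_nonempty.card_pos
    _ = ∑ p ∈ β.modes, ∑ k, absTransfer u k p := by
        rw [sum_orbit_modes, Finset.sum_comm]
    _ ≤ ∑ p ∈ β.modes, (8 : ℝ) := Finset.sum_le_sum fun p _ => hu.sum_absTransfer_left_le p
    _ ≤ Fintype.card Oct * 8 := by
        rw [Finset.sum_const, nsmul_eq_mul]
        gcongr
        exact β.card_modes_le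

/-! ### The norm and the spectral radius of the stretching matrix -/

open scoped Matrix.Norms.Operator

/-- The complexified stretching matrix. -/
noncomputable def complexStretching {N : ℕ} (u : Field N) : Matrix (Orbit N) (Orbit N) ℂ :=
  (stretchingMatrix u).map fun x : ℝ => (x : ℂ)

/-- The spectral radius is taken over `ℂ`; complexification preserves absolute values of entries,
hence row sums. -/
theorem norm_complexStretching {N : ℕ} (u : Field N) :
    ‖complexStretching u‖ = stretchingNorm u := by
  simp [stretchingNorm, complexStretching, Matrix.linfty_opNorm_def]

theorem stretchingNorm_nonneg {N : ℕ} (u : Field N) : 0 ≤ stretchingNorm u := norm_nonneg _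

theorem stretchingRadius_nonneg {N : ℕ} (u : Field N) : 0 ≤ stretchingRadius u :=
  ENNReal.toReal_nonneg

theorem criticalRatio_nonneg {N : ℕ} (u : Field N) : 0 ≤ criticalRatio u :=
  div_nonneg (stretchingRadius_nonneg u) (by positivity)

/-- An absolute bound for the stretching norm of unit-energy fields. -/
noncomputable def stretchingBound : ℝ := (8 + Fintype.card Oct * 8) / 2

theorem stretchingBound_pos : 0 < stretchingBound := by
  unfold stretchingBound; positivity

/-- Symmetrization makes each row sum of `V` at most the mean of a row sum and a column sum of `S`,
which is why both were needed. -/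
theorem IsUnitField.stretchingNorm_le {N : ℕ} {u : Field N} (hu : IsUnitField u) :
    stretchingNorm u ≤ stretchingBound := by
  lift stretchingBound to NNReal using stretchingBound_pos.le with b hb
  rw [stretchingNorm, Matrix.linfty_opNorm_def, NNReal.coe_le_coe]
  refine Finset.sup_le fun α _ => ?_
  rw [← NNReal.coe_le_coe, NNReal.coe_sum, hb, stretchingBound]
  have h : ∀ β, ((‖stretchingMatrix u α β‖₊ : NNReal) : ℝ) ≤
      |transferMatrix u α β| / 2 + |transferMatrix u β α| / 2 := fun β => by
    rw [coe_nnnorm, Real.norm_eq_abs, stretchingMatrix, Matrix.of_apply, abs_div, ← add_div,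
      abs_two]
    gcongr
    exact abs_add_le _ _
  refine (Finset.sum_le_sum fun β _ => h β).trans ?_
  rw [Finset.sum_add_distrib, ← Finset.sum_div, ← Finset.sum_div]
  linarith [hu.row_sum_le α, hu.col_sum_le α]

theorem spectralRadius_le_norm {n : Type*} [Fintype n] [DecidableEq n] (A : Matrix n n ℂ) :
    (spectralRadius ℂ A).toReal ≤ ‖A‖ := by
  cases isEmpty_or_nonempty n
  -- With no indices, as for the orbits at `N = 0`, the matrix algebra is trivial and the spectrum
  -- empty, so the spectral radius is 0.
  · have : Subsingleton (Matrix n n ℂ) := inferInstance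
    simp [spectralRadius, spectrum.of_subsingleton]
  · exact ENNReal.toReal_le_coe_of_le_coe (spectrum.spectralRadius_le_nnnorm A)

theorem stretchingRadius_le_norm {N : ℕ} (u : Field N) :
    stretchingRadius u ≤ stretchingNorm u :=
  (spectralRadius_le_norm (complexStretching u)).trans_eq (norm_complexStretching u)

/-! ### Continuity and measurability -/

theorem continuous_triadTransfer {N : ℕ} (k p q : Mode N) :
    Continuous fun u : Field N => triadTransfer u k p q := by
  unfold triadTransfer leray dotProduct
  simp only [Pi.smul_apply, Pi.sub_apply, smul_eq_mul]
  fun_prop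

theorem continuous_stretchingMatrix {N : ℕ} :
    Continuous fun u : Field N => stretchingMatrix u := by
  have h : ∀ α β, Continuous fun u : Field N => transferMatrix u α β := fun α β => by
    simp only [transferMatrix, Matrix.of_apply]
    exact continuous_const.mul (continuous_finsetSum _ fun k _ => continuous_finsetSum _ fun p _ =>
      continuous_finsetSum _ fun q _ => continuous_triadTransfer k p q)
  refine continuous_matrix fun α β => ?_
  simp only [stretchingMatrix, Matrix.of_apply]
  exact ((h α β).add (h β α)).div_const 2

theorem continuous_complexStretching {N : ℕ} :
    Continuous fun u : Field N => complexStretching u :=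
  continuous_stretchingMatrix.matrix_map Complex.continuous_ofReal

theorem measurable_stretchingNorm {N : ℕ} : Measurable fun u : Field N => stretchingNorm u :=
  (continuous_norm.comp continuous_stretchingMatrix).measurable

/-- Gelfand's formula exhibits the spectral radius as a limit of continuous functions. -/
theorem measurable_stretchingRadius {N : ℕ} : Measurable fun u : Field N => stretchingRadius u := by
  refine Measurable.ennreal_toReal (measurable_of_tendsto_metrizable
    (f := fun (n : ℕ) (u : Field N) => ENNReal.ofReal (‖complexStretching u ^ n‖ ^ (1 / n : ℝ)))
    (fun n => ?_) (tendsto_pi_nhds.2 fun u =>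
      spectrum.pow_norm_pow_one_div_tendsto_nhds_spectralRadius (complexStretching u)))
  have h : Measurable fun u : Field N => ‖complexStretching u ^ n‖ :=
    (continuous_norm.comp (continuous_complexStretching.pow n)).measurable
  exact (h.pow_const _).ennreal_ofReal

theorem measurable_criticalRatio {N : ℕ} : Measurable fun u : Field N => criticalRatio u :=
  measurable_stretchingRadius.div_const _

/-! ### Ensemble averages -/

/-- Total mass one comes from the coordinate description: the law is a pushforward of a product of
probability measures. -/
theorem IsIsotropicUnitEnergyEnsemble.isProbabilityMeasure {N : ℕ} {μ : Measure (Field N)}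
    (h : IsIsotropicUnitEnergyEnsemble N μ) : IsProbabilityMeasure μ := by
  obtain ⟨ν, rfl⟩ := h.independent_coordinates
  exact Measure.isProbabilityMeasure_map measurable_unitField.aemeasurable

theorem IsIsotropicUnitEnergyEnsemble.ae_isUnitField {N : ℕ} {μ : Measure (Field N)}
    (h : IsIsotropicUnitEnergyEnsemble N μ) : ∀ᵐ u ∂μ, IsUnitField u := by
  filter_upwards [h.incompressible, h.unit_energy] with u h1 h2 using ⟨h1, h2⟩

theorem integrable_and_integral_le {Ω : Type*} [MeasurableSpace Ω] {μ : Measure Ω}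
    [IsProbabilityMeasure μ] {f : Ω → ℝ} (hf : Measurable f) (h0 : ∀ x, 0 ≤ f x) {b : ℝ}
    (hb : ∀ᵐ x ∂μ, f x ≤ b) : Integrable f μ ∧ ∫ x, f x ∂μ ≤ b := by
  have hi : Integrable f μ := Integrable.of_bound hf.aestronglyMeasurable b (by
    filter_upwards [hb] with x hx
    rwa [Real.norm_eq_abs, abs_of_nonneg (h0 x)])
  refine ⟨hi, (integral_mono_ae hi (integrable_const b) hb).trans_eq ?_⟩
  simp

theorem IsIsotropicUnitEnergyEnsemble.stretchingNorm_bound {N : ℕ} {μ : Measure (Field N)}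
    (h : IsIsotropicUnitEnergyEnsemble N μ) :
    Integrable (fun u => stretchingNorm u) μ ∧ ∫ u, stretchingNorm u ∂μ ≤ stretchingBound := by
  have := h.isProbabilityMeasure
  refine integrable_and_integral_le measurable_stretchingNorm stretchingNorm_nonneg ?_
  filter_upwards [h.ae_isUnitField] with u hu using hu.stretchingNorm_le

theorem IsIsotropicUnitEnergyEnsemble.stretchingRadius_bound {N : ℕ} {μ : Measure (Field N)}
    (h : IsIsotropicUnitEnergyEnsemble N μ) :
    Integrable (fun u => stretchingRadius u) μ ∧
      ∫ u, stretchingRadius u ∂μ ≤ stretchingBound := by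
  have := h.isProbabilityMeasure
  refine integrable_and_integral_le measurable_stretchingRadius stretchingRadius_nonneg ?_
  filter_upwards [h.ae_isUnitField] with u hu
  exact (stretchingRadius_le_norm u).trans hu.stretchingNorm_le

theorem IsIsotropicUnitEnergyEnsemble.criticalRatio_bound {N : ℕ} {μ : Measure (Field N)}
    (h : IsIsotropicUnitEnergyEnsemble N μ) :
    Integrable (fun u => criticalRatio u) μ ∧
      ∫ u, criticalRatio u ∂μ ≤ stretchingBound / (N : ℝ) ^ 2 := by
  have := h.isProbabilityMeasure
  refine integrable_and_integral_le measurable_criticalRatio criticalRatio_nonneg ?_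
  filter_upwards [h.ae_isUnitField] with u hu
  -- At `N = 0` both quotients are 0 by convention, so no positivity of `N` is needed.
  exact div_le_div_of_nonneg_right ((stretchingRadius_le_norm u).trans hu.stretchingNorm_le)
    (by positivity)

end OrbitStretching

/-! ### Comparison of the uniform bound with the stated powers of `N` -/

theorem mainTheorem4 :
    (∀ ε : ℝ, 0 < ε → ∃ C : ℝ, 0 < C ∧ ∀ N : ℕ, 1 ≤ N →
      ∀ μ : MeasureTheory.Measure (OrbitStretching.Field N),
        OrbitStretching.IsIsotropicUnitEnergyEnsemble N μ →
          (Integrable (fun u => OrbitStretching.stretchingNorm u) μ ∧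
            ∫ u, OrbitStretching.stretchingNorm u ∂μ ≤ C * (N : ℝ) ^ (1 / 2 + ε)) ∧
          (Integrable (fun u => OrbitStretching.stretchingRadius u) μ ∧
            ∫ u, OrbitStretching.stretchingRadius u ∂μ ≤ C * (N : ℝ) ^ (1 / 2 + ε)) ∧
          (Integrable (fun u => OrbitStretching.criticalRatio u) μ ∧
            ∫ u, OrbitStretching.criticalRatio u ∂μ ≤ C * (N : ℝ) ^ (-(3 / 2) + ε))) ∧
    (∀ μ : (N : ℕ) → MeasureTheory.Measure (OrbitStretching.Field N),
      (∀ N : ℕ, 1 ≤ N → OrbitStretching.IsIsotropicUnitEnergyEnsemble N (μ N)) →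
        Tendsto (fun N : ℕ => ∫ u, OrbitStretching.criticalRatio u ∂(μ N)) atTop (𝓝 0)) := by
  have hC := OrbitStretching.stretchingBound_pos
  constructor
  · intro ε hε
    refine ⟨OrbitStretching.stretchingBound, hC, fun N hN μ hμ => ?_⟩
    have hN1 : (1 : ℝ) ≤ N := by exact_mod_cast hN
    -- For `N ≥ 1` a positive power of `N` is at least 1, so one constant serves all `ε`.
    have h1 : OrbitStretching.stretchingBound ≤
        OrbitStretching.stretchingBound * (N : ℝ) ^ (1 / 2 + ε) :=
      le_mul_of_one_le_right hC.le (Real.one_le_rpow hN1 (by positivity))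
    refine ⟨⟨hμ.stretchingNorm_bound.1, hμ.stretchingNorm_bound.2.trans h1⟩,
      ⟨hμ.stretchingRadius_bound.1, hμ.stretchingRadius_bound.2.trans h1⟩,
      ⟨hμ.criticalRatio_bound.1, hμ.criticalRatio_bound.2.trans ?_⟩⟩
    -- The actual decay is `N^(-2)`, and `-2 ≤ -3/2 + ε`.
    rw [div_eq_mul_inv, ← Real.rpow_natCast, ← Real.rpow_neg (by positivity)]
    refine mul_le_mul_of_nonneg_left (Real.rpow_le_rpow_of_exponent_le hN1 ?_) hC.le
    push_cast
    linarith
  · intro μ hμ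
    have hlim : Tendsto (fun N : ℕ => OrbitStretching.stretchingBound / (N : ℝ) ^ 2) atTop (𝓝 0) :=
      tendsto_const_nhds.div_atTop
        ((tendsto_pow_atTop two_ne_zero).comp tendsto_natCast_atTop_atTop)
    -- Squeeze between 0 and a constant times `N^(-2)`; the upper bound is only eventual because the
    -- ensemble property is given for `N ≥ 1`.
    refine tendsto_of_tendsto_of_tendsto_of_le_of_le' tendsto_const_nhds hlim
      (Eventually.of_forall fun N => integral_nonneg OrbitStretching.criticalRatio_nonneg) ?_
    filter_upwards [eventually_ge_atTop 1] with N hN using (hμ N hN).criticalRatio_bound.2
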